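/- Let $\Gamma$ be a connected finite multigraph without self-loops, with $n+1$ vertices ($n\ge 1$), enumerated as $v_0=v_*,v_1,\dots,v_n$, where $v_*$ is a chosen vertex called the sink. The Laplacian of $\Gamma$ is the matrix $L$ with rows and columns indexed by the vertices, whose entries are $L_{vv}=d(v)$, the degree of $v$, and, for $v\neq w$, $L_{vw}=-\#(v,w)$, where $\#(v,w)$ is the number of edges connecting $v$ and $w$. The reduced Laplacian $L'$ is the $n\times n$ matrix obtained from $L$ by deleting the row and the column of $v_*$, so that its $i$-th row and column correspond to $v_i$; we regard it as a real matrix. For $v,w\in\{v_1,\dots,v_n\}$ let $\mathcal S_2(v,w)$ be the set of ordered pairs $(\mathcal T_0,\mathcal T_1)$ of disjoint subgraphs of $\Gamma$, each of which is a (connected, non-empty) tree, such that every vertex of $\Gamma$ lies in $\mathcal T_0$ or $\mathcal T_1$, the sink $v_*$ lies in $\mathcal T_0$, and both $v$ and $w$ lie in $\mathcal T_1$. Then $L'$ is invertible, the sets $\mathcal S_2(v_i,v_j)$ are finite, and for all $1\le i,j\le n$ $$\bigl((L')^{-1}\bigr)_{ij}=\frac{|\mathcal S_2(v_i,v_j)|}{\det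 L'}.$$ In particular, all entries of $(L')^{-1}$ are non-negative. -/

import Mathlib

open scoped Graph

namespace Graph

variable {α β : Type*}

/-- A multigraph is connected if it has a vertex and any two of its vertices are joined by a
walk. -/
structure Connected (G : Graph α β) : Prop where
  nonempty : V(G).Nonempty
  reachable : ∀ ⦃x⦄, x ∈ V(G) → ∀ ⦃y⦄, y ∈ V(G) → Relation.ReflTransGen G.Adj x y

/-- `G` contains a cycle: distinct vertices `x 0, …, x k` and distinct edges `e 0, …, e k` such
that `e i` joins `x i` to `x (i + 1)`, the indices being read modulo `k + 1`. A loop is a cycle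
with `k = 0`, and a pair of parallel edges is a cycle with `k = 1`. -/
def HasCycle (G : Graph α β) : Prop :=
  ∃ (k : ℕ) (x : Fin (k + 1) → α) (e : Fin (k + 1) → β),
    Function.Injective x ∧ Function.Injective e ∧ ∀ i, G.IsLink (e i) (x i) (x (i + 1))

/-- A tree is a connected multigraph without cycles. It has at least one vertex. -/
structure IsTree (G : Graph α β) : Prop where
  connected : G.Connected
  acyclic : ¬ G.HasCycle

/-- `T 0, …, T (k - 1)` is a spanning `k`-forest of `G`: the `T i` are pairwise disjoint subgraphs
of `G`, each of them is a tree, and each vertex of `G` lies in one of them. -/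
structure IsSpanningForest (G : Graph α β) {k : ℕ} (T : Fin k → Graph α β) : Prop where
  le : ∀ i, T i ≤ G
  isTree : ∀ i, (T i).IsTree
  disjoint : Pairwise fun i j ↦ Disjoint V(T i) V(T j)
  spanning : ∀ ⦃x⦄, x ∈ V(G) → ∃ i, x ∈ V(T i)

/-- The set `S₂(v, w)`, relative to the sink `s`, of the ordered pairs `(T₀, T₁)` of trees that form
a spanning 2-forest of `G` with `s` in `T₀` and both `v` and `w` in `T₁`. -/
def spanningTwoForests (G : Graph α β) (s v w : α) : Set (Graph α β × Graph α β) :=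
  {T | G.IsSpanningForest ![T.1, T.2] ∧ s ∈ V(T.1) ∧ v ∈ V(T.2) ∧ w ∈ V(T.2)}

/-- The number `#(v, w)` of edges connecting `v` and `w`. -/
noncomputable def edgeCount (G : Graph α β) (v w : α) : ℕ :=
  {e | G.IsLink e v w}.ncard

/-- The degree of a vertex: the number of edges at it, a loop (if there is one) counted twice. -/
noncomputable def valence (G : Graph α β) (v : α) : ℕ :=
  (G.incidenceSet v).ncard + (G.loopSet v).ncard

open Classical in
/-- The Laplacian matrix, over `ℝ`. -/
noncomputable def laplacian (G : Graph α β) : Matrix V(G) V(G) ℝ :=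
  Matrix.of fun v w ↦ if v = w then (G.valence v : ℝ) else -(G.edgeCount v w : ℝ)

/-- The reduced Laplacian for an enumeration `v 0, v 1, …, v n` of the vertices, with sink `v 0`: it
is the Laplacian with the row and the column of the sink deleted. The row (column) with index
`i : Fin n` is that of the vertex `v i.succ`. -/
noncomputable def reducedLaplacian (G : Graph α β) {n : ℕ} (v : Fin (n + 1) ≃ V(G)) :
    Matrix (Fin n) (Fin n) ℝ :=
  G.laplacian.submatrix (fun i ↦ v i.succ) (fun i ↦ v i.succ)

end Graph

/-! Row `k` of the reduced Laplacian is the sum, over the edges at `v k.succ`, of the vector of that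
vertex minus the vector of the other end, the sink having vector zero. The determinant is linear in
each row, so it becomes a sum over choices of one edge per non-sink vertex, that is, of a parent map
`F` with `F 0 = 0`. The summand `(parentMatrix F).det` is 1 if `F` leads every vertex to the sink,
and 0 if `F` has a cycle off the sink, because the vertex vectors round the cycle add up to a left
null vector. A connected graph has a choice of the first kind, so the determinant is positive.

The adjugate at `i j` is expanded in the same way. Its row `j` is replaced by a basis vector, so no
edge is chosen at `j`, whose parent may be taken to be the sink. Then the summand is 1 if `F`
descends to the sink and `i` reaches `j`, and 0 otherwise (`adjugate_parentMatrix`). Cutting the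
artificial link from `j` to the sink leaves a spanning 2-forest: the vertices that reach `j` form
the tree rooted at `j`, the others the tree rooted at the sink. Since a rooted tree and its parent
function determine each other, this is a bijection (`bijOn_forestOf`). -/

namespace Graph

/-! ### Rooted trees and parent functions -/

section Trees

variable {α β : Type*} {T : Graph α β}

/-- A closed walk of positive length in which consecutive edges differ contains a cycle. -/
lemma hasCycle_of_closed_walk (m : ℕ) (x : ℕ → α) (e : ℕ → β) (hm : 0 < m)
    (hl : ∀ i < m, T.IsLink (e i) (x i) (x (i + 1))) (hb : ∀ i, i + 1 < m → e i ≠ e (i + 1))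
    (hx : x 0 = x m) : T.HasCycle := by
  induction m using Nat.strong_induction_on generalizing x e with
  | h m ih =>
    -- Either a shorter closed subwalk exists, or the only repeated vertex is the common start and
    -- end.
    by_cases H : ∃ i j, i < j ∧ j ≤ m ∧ j - i < m ∧ x i = x j
    · obtain ⟨i, j, hij, hjm, hlt, hxij⟩ := H
      refine ih (j - i) hlt (fun t ↦ x (i + t)) (fun t ↦ e (i + t)) (by lia)
        (fun t ht ↦ hl (i + t) (by lia)) (fun t ht ↦ hb (i + t) (by lia)) ?_
      simpa [Nat.add_sub_cancel' hij.le] using hxij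
    · have hinj : ∀ i j, i < j → j ≤ m → x i = x j → i = 0 ∧ j = m := fun i j hij hj h ↦ by
        by_contra hne
        exact H ⟨i, j, hij, hj, by lia, h⟩
      obtain ⟨k, rfl⟩ : ∃ k, m = k + 1 := ⟨m - 1, by lia⟩
      have hedge : ∀ a b, a < b → b < k + 1 → e a ≠ e b := fun a b hab hbk h ↦ by
        have h₁ := hl a (by lia)
        rw [h] at h₁
        rcases h₁.eq_and_eq_or_eq_and_eq (hl b hbk) with ⟨h₂, -⟩ | ⟨h₂, h₃⟩
        · have := hinj a b hab hbk.le h₂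
          lia
        · have h₄ := hinj a (b + 1) (by lia) (by lia) h₂
          rcases Nat.lt_or_ge (a + 1) b with h₅ | h₅
          · have := hinj (a + 1) b h₅ hbk.le h₃
            lia
          · obtain rfl : b = a + 1 := by lia
            exact hb a hbk h
      refine ⟨k, fun i ↦ x i, fun i ↦ e i, fun i j h ↦ ?_, fun i j h ↦ ?_, fun i ↦ ?_⟩
      · by_contra hne
        rcases lt_or_gt_of_ne hne with h' | h'
        · have := hinj i j h' (by lia) h
          lia
        · have := hinj j i h' (by lia) h.symm
          lia
      · by_contra hne
        rcases lt_or_gt_of_ne hne with h' | h'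
        · exact hedge i j h' j.2 h
        · exact hedge j i h' i.2 h.symm
      · have h := hl i i.2
        rcases eq_or_ne i (Fin.last k) with rfl | hi
        · simpa [← hx] using h
        · have : ((i + 1 : Fin (k + 1)) : ℕ) = i + 1 := by
            rw [Fin.val_add_one, if_neg hi]
          simpa only [this] using h

/-- `T.NonBacktracking r a l`: there is a walk from `r` to `a` whose consecutive edges differ, with
last edge `l` (`none` for the walk of length zero). -/
inductive NonBacktracking (T : Graph α β) (r : α) : α → Option β → Prop
  | nil : NonBacktracking T r r none
  | snoc {a b : α} {l : Option β} {e : β} (h : NonBacktracking T r a l) (he : T.IsLink e a b)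
      (hl : l ≠ some e) : NonBacktracking T r b (some e)

lemma NonBacktracking.exists_walk [Nonempty β] {r a : α} {l : Option β}
    (h : T.NonBacktracking r a l) :
    ∃ (m : ℕ) (x : ℕ → α) (e : ℕ → β), x 0 = r ∧ x m = a ∧
      (∀ i < m, T.IsLink (e i) (x i) (x (i + 1))) ∧ (∀ i, i + 1 < m → e i ≠ e (i + 1)) ∧
      (l.isSome → 0 < m) ∧ ∀ i, m = i + 1 → l = some (e i) := by
  induction h with
  | nil =>
    exact ⟨0, fun _ ↦ r, fun _ ↦ Classical.arbitrary β, rfl, rfl, by simp, by simp, by simp,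
      by simp⟩
  | @snoc a b l f h he hl ih =>
    obtain ⟨m, x, e, h0, hm, hlink, hb, -, hlast⟩ := ih
    refine ⟨m + 1, fun i ↦ if i ≤ m then x i else b, fun i ↦ if i < m then e i else f,
      by simpa using h0, by simp, fun i hi ↦ ?_, fun i hi ↦ ?_, by simp, fun i hi ↦ ?_⟩
    · rcases Nat.lt_or_ge i m with h' | h'
      · simpa [h', h'.le, Nat.succ_le_of_lt h'] using hlink i h'
      · obtain rfl : i = m := by lia
        simpa [hm] using he
    · rcases Nat.lt_or_ge (i + 1) m with h' | h'
      · simpa [h', (Nat.lt_succ_self i).trans h'] using hb i h'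
      · obtain rfl : m = i + 1 := by lia
        have := hlast i rfl
        simp only [Nat.lt_succ_self, if_true, lt_irrefl, if_false]
        rintro rfl
        exact hl this
    · obtain rfl : i = m := by lia
      simp

lemma NonBacktracking.hasCycle {r : α} {e : β} (h : T.NonBacktracking r r (some e)) :
    T.HasCycle := by
  have : Nonempty β := ⟨e⟩
  obtain ⟨m, x, e, h0, hm, hlink, hb, hpos, -⟩ := h.exists_walk
  exact hasCycle_of_closed_walk m x e (hpos rfl) hlink hb (h0.trans hm.symm)

/-- `g` assigns to each vertex of `T` other than the root `r` an edge that leads to a vertex of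
smaller height `h`. -/
structure IsParent (T : Graph α β) (r : α) (g : α → Option β) (h : α → ℕ) : Prop where
  root_mem : r ∈ V(T)
  root : g r = none
  step : ∀ ⦃a⦄, a ∈ V(T) → a ≠ r → ∃ e b, g a = some e ∧ T.IsLink e a b ∧ h b < h a

namespace IsParent

variable {r : α} {g : α → Option β} {h : α → ℕ}

lemma height_lt (H : T.IsParent r g h) {a b : α} {e : β} (he : g a = some e)
    (hl : T.IsLink e a b) : h b < h a := by
  have ha : a ≠ r := by
    rintro rfl
    simp [H.root] at he
  obtain ⟨e', b', he', hl', hlt⟩ := H.step hl.left_mem ha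
  obtain rfl : e = e' := by simpa [he] using he'
  rwa [hl.right_unique hl']

lemma ne_of_isLink (H : T.IsParent r g h) {a b : α} {e : β} (he : g a = some e)
    (hl : T.IsLink e a b) : g b ≠ some e := fun hb ↦
  (H.height_lt he hl).asymm (H.height_lt hb hl.symm)

lemma nonBacktracking (H : T.IsParent r g h) {a : α} (ha : a ∈ V(T)) :
    T.NonBacktracking r a (g a) := by
  induction hn : h a using Nat.strong_induction_on generalizing a with
  | h n ih =>
    rcases eq_or_ne a r with rfl | hne
    · rw [H.root]
      exact .nil
    · obtain ⟨e, b, he, hl, hlt⟩ := H.step ha hne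
      rw [he]
      exact .snoc (ih (h b) (hn ▸ hlt) hl.right_mem rfl) hl.symm (H.ne_of_isLink he hl)

/-- The walk is continued along parent edges down to the root. It never backtracks, since each edge
to a parent differs from the one just used, so it ends as a closed walk at `r`. -/
lemma hasCycle_of_nonBacktracking (H : T.IsParent r g h) {a : α} {e : β} (ha : a ∈ V(T))
    (hw : T.NonBacktracking r a (some e)) (he : g a ≠ some e) : T.HasCycle := by
  induction hn : h a using Nat.strong_induction_on generalizing a e with
  | h n ih =>
    rcases eq_or_ne a r with rfl | hne
    · exact hw.hasCycle
    · obtain ⟨f, b, hf, hl, hlt⟩ := H.step ha hne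
      exact ih (h b) (hn ▸ hlt) hl.right_mem (.snoc hw hl (by rwa [← hf, ne_comm]))
        (H.ne_of_isLink hf hl) rfl

/-- In an acyclic graph, each edge is the edge from some vertex to its parent. -/
lemma exists_eq_some (H : T.IsParent r g h) (hT : ¬ T.HasCycle) {e : β} (he : e ∈ E(T)) :
    ∃ a ∈ V(T), g a = some e := by
  by_contra! hne
  obtain ⟨a, b, hl⟩ := exists_isLink_of_mem_edgeSet he
  exact hT <| H.hasCycle_of_nonBacktracking hl.right_mem
    (.snoc (H.nonBacktracking hl.left_mem) hl (hne a hl.left_mem)) (hne b hl.right_mem)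

lemma reflTransGen (H : T.IsParent r g h) {a : α} (ha : a ∈ V(T)) :
    Relation.ReflTransGen T.Adj a r := by
  induction hn : h a using Nat.strong_induction_on generalizing a with
  | h n ih =>
    rcases eq_or_ne a r with rfl | hne
    · exact .refl
    · obtain ⟨e, b, he, hl, hlt⟩ := H.step ha hne
      exact .head hl.adj (ih (h b) (hn ▸ hlt) hl.right_mem rfl)

lemma connected (H : T.IsParent r g h) : T.Connected where
  nonempty := ⟨r, H.root_mem⟩
  reachable _ hx _ hy := (H.reflTransGen hx).trans
    (Std.Symm.symm _ _ (H.reflTransGen hy))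

lemma eq_some_of_height_le (H : T.IsParent r g h) (hE : ∀ e ∈ E(T), ∃ a ∈ V(T), g a = some e)
    {a b : α} {e : β} (hl : T.IsLink e a b) (hab : h b ≤ h a) : g a = some e := by
  obtain ⟨c, hc, hce⟩ := hE e hl.edge_mem
  rcases eq_or_ne c r with rfl | hne
  · simp [H.root] at hce
  obtain ⟨e', d, he', hl', -⟩ := H.step hc hne
  obtain rfl : e = e' := by simpa [hce] using he'
  rcases hl'.left_eq_or_eq hl with rfl | rfl
  · exact hce
  · exact absurd (H.height_lt hce hl.symm) hab.not_gt

lemma isTree (H : T.IsParent r g h) (hE : ∀ e ∈ E(T), ∃ a ∈ V(T), g a = some e) : T.IsTree where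
  connected := H.connected
  acyclic := by
    rintro ⟨k, x, e, -, he, hl⟩
    -- At a highest vertex of the cycle both cycle edges are the parent edge. They therefore
    -- coincide, and the cycle is a loop, which contradicts the drop in height.
    obtain ⟨i, hi⟩ := Finite.exists_max fun i ↦ h (x i)
    have h₁ : g (x i) = some (e i) := H.eq_some_of_height_le hE (hl i) (hi (i + 1))
    have hl' := hl (i - 1)
    rw [sub_add_cancel] at hl'
    have h₂ : g (x i) = some (e (i - 1)) := H.eq_some_of_height_le hE hl'.symm (hi (i - 1))
    have h₃ : i = i - 1 := he (by simpa [h₁] using h₂)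
    have h₄ : i + 1 = i := by
      nth_rewrite 1 [h₃]
      exact sub_add_cancel i 1
    have h₅ := H.height_lt h₁ (hl i)
    rw [h₄] at h₅
    exact lt_irrefl _ h₅

/-- The parent function of a rooted tree is unique. -/
lemma eqOn (H : T.IsParent r g h) {g' : α → Option β} {h' : α → ℕ} (H' : T.IsParent r g' h')
    (hT : ¬ T.HasCycle) : Set.EqOn g g' V(T) := by
  intro a ha
  by_contra hne
  induction hn : h' a using Nat.strong_induction_on generalizing a with
  | h n ih =>
    rcases eq_or_ne a r with rfl | har
    · exact hne (H.root.trans H'.root.symm)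
    obtain ⟨e, b, he, hl, hlt⟩ := H'.step ha har
    -- The edge `e` from `a` to its `g'`-parent `b` is also a `g`-parent edge, of `a` or of `b`. In
    -- the second case `g` and `g'` differ at the lower vertex `b`.
    obtain ⟨c, hc, hce⟩ := H.exists_eq_some hT hl.edge_mem
    rcases eq_or_ne c r with rfl | hcr
    · simp [H.root] at hce
    obtain ⟨e', d, he', hl', -⟩ := H.step hc hcr
    obtain rfl : e = e' := by simpa [hce] using he'
    rcases hl'.left_eq_or_eq hl with rfl | rfl
    · exact hne (hce.trans he.symm)
    · exact ih _ (hn ▸ hlt) hc (fun h₀ ↦ H'.ne_of_isLink he hl (h₀.symm.trans hce)) rfl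

end IsParent

/-- A connected graph has a parent function for each root. -/
lemma Connected.exists_isParent (hT : T.Connected) {r : α} (hr : r ∈ V(T)) :
    ∃ g h, T.IsParent r g h := by
  -- `D n a` says that some walk with exactly `n` edges joins `a` to `r`; the height is then the
  -- distance to `r`.
  let D : ℕ → α → Prop := fun n ↦ n.rec (fun a ↦ a = r) fun _ P a ↦ ∃ b, T.Adj a b ∧ P b
  have hD : ∀ {a}, Relation.ReflTransGen T.Adj a r → ∃ n, D n a := fun h ↦ by
    induction h using Relation.ReflTransGen.head_induction_on with
    | refl => exact ⟨0, rfl⟩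
    | head hab _ ih => exact ih.elim fun n hn ↦ ⟨n + 1, _, hab, hn⟩
  let h : α → ℕ := fun a ↦ sInf {n | D n a}
  have key : ∀ a, ∃ o : Option β, (a = r → o = none) ∧
      (a ∈ V(T) → a ≠ r → ∃ e b, o = some e ∧ T.IsLink e a b ∧ h b < h a) := fun a ↦ by
    by_cases ha : a ∈ V(T) ∧ a ≠ r
    · have hmem : D (h a) a := Nat.sInf_mem (hD (hT.reachable ha.1 hr))
      rcases hn : h a with _ | n
      · rw [hn] at hmem
        exact absurd hmem ha.2
      · rw [hn] at hmem
        obtain ⟨b, ⟨e, hl⟩, hb⟩ := hmem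
        exact ⟨some e, fun h' ↦ absurd h' ha.2, fun _ _ ↦
          ⟨e, b, rfl, hl, Nat.lt_succ_of_le (Nat.sInf_le hb)⟩⟩
    · exact ⟨none, fun _ ↦ rfl, fun h₁ h₂ ↦ absurd ⟨h₁, h₂⟩ ha⟩
  choose g hg₁ hg₂ using key
  exact ⟨g, h, hr, hg₁ r rfl, fun a ↦ hg₂ a⟩

end Trees

end Graph

namespace Graph

/-! ### Determinants and cofactors of parent matrices -/

section ParentMatrix

open Matrix

variable {n : ℕ}

/-- The vector of a vertex: zero for the sink `0`, a standard basis vector for the others. -/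
def vertexVec : Fin (n + 1) → Fin n → ℝ :=
  Fin.cases 0 fun i ↦ Pi.single i 1

@[simp] lemma vertexVec_zero : vertexVec (0 : Fin (n + 1)) = 0 := rfl

@[simp] lemma vertexVec_succ (i : Fin n) : vertexVec i.succ = Pi.single i 1 := rfl

lemma vertexVec_apply (x : Fin (n + 1)) (l : Fin n) :
    vertexVec x l = if x = l.succ then 1 else 0 := by
  refine Fin.cases ?_ (fun i ↦ ?_) x
  · simp [(Fin.succ_ne_zero l).symm]
  · simp [Pi.single_apply, eq_comm]

/-- The matrix whose row with index `i` is the vector of `i.succ` minus that of its parent. -/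
def parentMatrix (F : Fin (n + 1) → Fin (n + 1)) : Matrix (Fin n) (Fin n) ℝ :=
  Matrix.of fun i ↦ vertexVec i.succ - vertexVec (F i.succ)

/-- There is a height function that decreases along `F` away from `0`. -/
def Descends (F : Fin (n + 1) → Fin (n + 1)) : Prop :=
  ∃ h : Fin (n + 1) → ℕ, ∀ x ≠ 0, h (F x) < h x

/-- `y` is an iterate of `x` under `F`. -/
def Reaches (F : Fin (n + 1) → Fin (n + 1)) (x y : Fin (n + 1)) : Prop :=
  ∃ m : ℕ, F^[m] x = y

variable {F : Fin (n + 1) → Fin (n + 1)}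

lemma Reaches.refl (x : Fin (n + 1)) : Reaches F x x := ⟨0, rfl⟩

lemma reaches_iff {x y : Fin (n + 1)} : Reaches F x y ↔ x = y ∨ Reaches F (F x) y := by
  constructor
  · rintro ⟨m, hm⟩
    cases m with
    | zero => exact .inl hm
    | succ m => exact .inr ⟨m, hm⟩
  · rintro (h | ⟨m, hm⟩)
    · exact ⟨0, h⟩
    · exact ⟨m + 1, hm⟩

lemma not_reaches_zero (h0 : F 0 = 0) {y : Fin (n + 1)} (hy : y ≠ 0) : ¬ Reaches F 0 y := by
  rintro ⟨m, hm⟩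
  exact hy (by rw [← hm, Function.iterate_fixed h0])

lemma height_le_of_reaches {h : Fin (n + 1) → ℕ} (hh : ∀ x ≠ 0, h (F x) < h x) (h0 : F 0 = 0)
    {x y : Fin (n + 1)} (hy : y ≠ 0) (hxy : Reaches F x y) : h y ≤ h x := by
  obtain ⟨m, hm⟩ := hxy
  induction m generalizing x with
  | zero => exact hm ▸ le_rfl
  | succ m ih =>
    have hx : x ≠ 0 := by
      rintro rfl
      exact not_reaches_zero h0 hy ⟨_, hm⟩
    exact (ih hm).trans (hh x hx).le

/-- Ordered by height the matrix is block triangular with identity diagonal blocks, because a parent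
is strictly lower than its child. -/
lemma det_parentMatrix (hF : Descends F) : (parentMatrix F).det = 1 := by
  obtain ⟨h, hh⟩ := hF
  have key : ∀ i j : Fin n, h i.succ ≤ h j.succ → parentMatrix F i j = if i = j then 1 else 0 := by
    intro i j hij
    have : F i.succ ≠ j.succ := fun he ↦ by
      have := hh i.succ (Fin.succ_ne_zero i)
      rw [he] at this
      lia
    simp [parentMatrix, vertexVec_apply, this, Fin.succ_inj, -vertexVec_succ]
  have htri : (parentMatrix F).BlockTriangular fun i ↦ OrderDual.toDual (h i.succ) := fun i j hij ↦ by
    have hij' : h i.succ < h j.succ := hij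
    rw [key i j hij'.le, if_neg (by rintro rfl; exact lt_irrefl _ hij')]
  rw [htri.det]
  refine Finset.prod_eq_one fun a _ ↦ ?_
  suffices hone : (parentMatrix F).toSquareBlock (fun i ↦ OrderDual.toDual (h i.succ)) a = 1 by
    rw [hone, det_one]
  ext i j
  have hij : h i.1.succ = h j.1.succ := congrArg OrderDual.ofDual (i.2.trans j.2.symm)
  rw [toSquareBlock_def, of_apply, key i j hij.le, one_apply]
  simp only [Subtype.ext_iff]

-- Row by row this is the recursion `reaches_iff`: apart from `k` itself, `k` reaches exactly what
-- its parent reaches.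
open Classical in
lemma parentMatrix_mul_reaches (hF : Descends F) (h0 : F 0 = 0) :
    parentMatrix F *
      Matrix.of (fun k l : Fin n ↦ if Reaches F k.succ l.succ then (1 : ℝ) else 0) = 1 := by
  obtain ⟨h, hh⟩ := hF
  ext k l
  have hvec : ∀ x : Fin (n + 1), ∑ m : Fin n, vertexVec x m *
      (if Reaches F m.succ l.succ then (1 : ℝ) else 0) = if Reaches F x l.succ then 1 else 0 := by
    refine Fin.cases ?_ fun i ↦ ?_
    · simp [not_reaches_zero h0 (Fin.succ_ne_zero l)]
    · rw [vertexVec_succ, Finset.sum_eq_single i (fun m _ hm ↦ by simp [hm]) (by simp)]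
      simp
  simp only [mul_apply, parentMatrix, of_apply, Pi.sub_apply, sub_mul, Finset.sum_sub_distrib, hvec]
  rw [one_apply]
  have hkl : Reaches F k.succ l.succ ↔ k = l ∨ Reaches F (F k.succ) l.succ := by
    rw [reaches_iff, Fin.succ_inj]
  have hnot : k = l → ¬ Reaches F (F k.succ) l.succ := by
    rintro rfl hr
    have := height_le_of_reaches hh h0 (Fin.succ_ne_zero k) hr
    exact absurd (hh _ (Fin.succ_ne_zero k)) this.not_gt
  by_cases h₁ : k = l
  · have h₂ := hnot h₁
    subst h₁
    simp [h₂, Reaches.refl]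
  · by_cases h₂ : Reaches F (F k.succ) l.succ <;> simp [hkl, h₁, h₂]

lemma exists_periodic (hF : ¬ Descends F) :
    ∃ p m, 0 < m ∧ F^[m] p = p ∧ p ≠ 0 ∧ ∀ t, F^[t] p ≠ 0 := by
  -- If every orbit met 0, the first hitting time would be a height function.
  obtain ⟨x, hx⟩ : ∃ x, ∀ t, F^[t] x ≠ 0 := by
    by_contra! hall
    classical
    refine hF ⟨fun x ↦ Nat.find (hall x), fun x hx ↦ ?_⟩
    have hspec := Nat.find_spec (hall x)
    show Nat.find (hall (F x)) < Nat.find (hall x)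
    rcases hn : Nat.find (hall x) with _ | m
    · rw [hn] at hspec
      exact absurd hspec hx
    · rw [hn] at hspec
      exact Nat.lt_succ_of_le (Nat.find_min' (hall (F x)) hspec)
  obtain ⟨a, b, hab, he⟩ : ∃ a b : ℕ, a < b ∧ F^[a] x = F^[b] x := by
    obtain ⟨a, b, hne, he⟩ := Finite.exists_ne_map_eq_of_infinite fun t : ℕ ↦ F^[t] x
    rcases lt_or_gt_of_ne hne with h | h
    · exact ⟨a, b, h, he⟩
    · exact ⟨b, a, h, he.symm⟩
  refine ⟨F^[a] x, b - a, by lia, ?_, hx a, fun t ↦ ?_⟩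
  · rw [← Function.iterate_add_apply, Nat.sub_add_cancel hab.le, he]
  · rw [← Function.iterate_add_apply]
    exact hx _

/-- The vectors along the orbit sum to a left null vector by telescoping; the sum is nonzero since
its entries are non-negative and `p` contributes 1. -/
lemma det_eq_zero_of_periodic {A : Matrix (Fin n) (Fin n) ℝ} {p : Fin (n + 1)} {m : ℕ} (hm : 0 < m)
    (hp : F^[m] p = p) (hp0 : p ≠ 0)
    (hA : ∀ t, vertexVec (F^[t] p) ᵥ* A = vertexVec (F^[t] p) - vertexVec (F^[t + 1] p)) :
    A.det = 0 := by
  rw [← Matrix.exists_vecMul_eq_zero_iff]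
  refine ⟨∑ t ∈ Finset.range m, vertexVec (F^[t] p), fun hz ↦ ?_, ?_⟩
  · obtain ⟨i, rfl⟩ := Fin.exists_succ_eq.2 hp0
    have h₁ := congrFun hz i
    rw [Finset.sum_apply, Pi.zero_apply, Finset.sum_eq_zero_iff_of_nonneg] at h₁
    · have := h₁ 0 (Finset.mem_range.2 hm)
      simp at this
    · intro t _
      rw [vertexVec_apply]
      positivity
  · rw [Matrix.sum_vecMul, Finset.sum_congr rfl fun t _ ↦ hA t,
      Finset.sum_range_sub' (fun t ↦ vertexVec (F^[t] p))]
    simp [hp]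

lemma det_parentMatrix_eq_zero (hF : ¬ Descends F) : (parentMatrix F).det = 0 := by
  obtain ⟨p, m, hm, hp, hp0, hne⟩ := exists_periodic hF
  refine det_eq_zero_of_periodic hm hp hp0 fun t ↦ ?_
  obtain ⟨k, hk⟩ := Fin.exists_succ_eq.2 (hne t)
  rw [Function.iterate_succ_apply', ← hk, vertexVec_succ, single_one_vecMul]
  rfl

open Classical in
/-- The cofactors of a parent matrix for rows of roots. -/
lemma adjugate_parentMatrix (h0 : F 0 = 0) {j : Fin n} (hj : F j.succ = 0) (i : Fin n) :
    (parentMatrix F).adjugate i j = if Descends F ∧ Reaches F i.succ j.succ then 1 else 0 := by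
  by_cases hF : Descends F
  · have hR := parentMatrix_mul_reaches hF h0
    have : (parentMatrix F).adjugate =
        Matrix.of (fun k l : Fin n ↦ if Reaches F k.succ l.succ then (1 : ℝ) else 0) := by
      rw [← mul_one (parentMatrix F).adjugate, ← hR, ← mul_assoc, adjugate_mul,
        det_parentMatrix hF, one_smul, one_mul]
    simp [this, hF]
  · obtain ⟨p, m, hm, hp, hp0, hne⟩ := exists_periodic hF
    simp only [hF, false_and, if_false, adjugate_apply]
    refine det_eq_zero_of_periodic hm hp hp0 fun t ↦ ?_
    obtain ⟨k, hk⟩ := Fin.exists_succ_eq.2 (hne t)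
    -- The periodic orbit avoids `j`, whose parent is the sink, so the replaced row plays no role in
    -- the null vector.
    have hkj : k ≠ j := by
      rintro rfl
      exact hne (t + 1) (by rw [Function.iterate_succ_apply', ← hk, hj])
    rw [Function.iterate_succ_apply', ← hk, vertexVec_succ, single_one_vecMul]
    ext l
    simp [updateRow_ne hkj, parentMatrix]

end ParentMatrix

end Graph

/-! ### Expansion of the reduced Laplacian over choices of edges -/

namespace Graph

open Matrix

variable {α β : Type*} {G : Graph α β} {n : ℕ} {v : Fin (n + 1) ≃ V(G)}

open Classical in
/-- The other end of the edge `e` at the vertex with index `x`. -/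
noncomputable def neighbor (G : Graph α β) (v : Fin (n + 1) ≃ V(G)) (x : Fin (n + 1)) (e : β) :
    Fin (n + 1) :=
  if h : G.Inc e (v x) then v.symm ⟨h.other, h.inc_other.vertex_mem⟩ else 0

lemma Inc.isLink_neighbor {x : Fin (n + 1)} {e : β} (h : G.Inc e (v x)) :
    G.IsLink e (v x) (v (G.neighbor v x e)) := by
  simp [neighbor, h]

lemma IsLink.neighbor_eq {x : Fin (n + 1)} {e : β} {a : α} (h : G.IsLink e (v x) a) :
    (v (G.neighbor v x e) : α) = a :=
  h.inc_left.isLink_neighbor.right_unique h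

/-- The parent function on indices that belongs to a choice `p` of edges. The parent of the sink, and
of each vertex without a chosen edge, is the sink. -/
noncomputable def parentMap (G : Graph α β) (v : Fin (n + 1) ≃ V(G)) (p : Fin n → Option β) :
    Fin (n + 1) → Fin (n + 1) :=
  Fin.cases 0 fun k ↦ (p k).elim 0 (G.neighbor v k.succ)

@[simp] lemma parentMap_zero (p : Fin n → Option β) : G.parentMap v p 0 = 0 := rfl

lemma parentMap_succ (p : Fin n → Option β) (k : Fin n) :
    G.parentMap v p k.succ = (p k).elim 0 (G.neighbor v k.succ) := rfl

lemma parentMap_eq_zero {p : Fin n → Option β} {k : Fin n} (h : p k = none) :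
    G.parentMap v p k.succ = 0 := by
  simp [parentMap_succ, h]

lemma parentMap_eq {p : Fin n → Option β} {k : Fin n} {e : β} {a : α} (h : p k = some e)
    (hl : G.IsLink e (v k.succ) a) : (v (G.parentMap v p k.succ) : α) = a := by
  rw [parentMap_succ, h]
  exact hl.neighbor_eq

/-- The edges at a vertex. -/
noncomputable def incidenceFinset (G : Graph α β) (hE : E(G).Finite) (a : α) : Finset β :=
  (hE.subset (G.incidenceSet_subset_edgeSet a)).toFinset

@[simp] lemma mem_incidenceFinset {hE : E(G).Finite} {a : α} {e : β} :
    e ∈ G.incidenceFinset hE a ↔ G.Inc e a := by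
  simp [incidenceFinset]

/-- The possible edges from the vertex with index `k.succ` to its parent. -/
noncomputable def edgeChoices (hE : E(G).Finite) (v : Fin (n + 1) ≃ V(G)) (k : Fin n) :
    Finset (Option β) :=
  (G.incidenceFinset hE (v k.succ)).map .some

lemma mem_edgeChoices {hE : E(G).Finite} {k : Fin n} {o : Option β} :
    o ∈ edgeChoices hE v k ↔ ∃ e, o = some e ∧ G.Inc e (v k.succ) := by
  simp [edgeChoices, eq_comm, and_comm]

lemma reducedLaplacian_row [G.Loopless] (hE : E(G).Finite) (k : Fin n) :
    G.reducedLaplacian v k = ∑ o ∈ edgeChoices hE v k,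
      (vertexVec k.succ - vertexVec (o.elim 0 (G.neighbor v k.succ))) := by
  classical
  ext l
  rw [edgeChoices, Finset.sum_map, Finset.sum_apply]
  simp only [Function.Embedding.some_apply, Option.elim_some, Pi.sub_apply, vertexVec_apply,
    Fin.succ_inj, reducedLaplacian, laplacian, submatrix_apply, of_apply, Finset.sum_sub_distrib,
    v.injective.eq_iff]
  rcases eq_or_ne k l with rfl | hkl
  · rw [Finset.sum_eq_zero (f := fun e ↦ if G.neighbor v k.succ e = k.succ then (1 : ℝ) else 0)]
    · have hloop : G.loopSet (v k.succ) = ∅ := by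
        ext e
        simp
      rw [if_pos rfl, valence, hloop, Set.ncard_empty, add_zero, if_pos rfl, Finset.sum_const,
        nsmul_eq_mul, mul_one, sub_zero, incidenceFinset,
        Set.ncard_eq_toFinset_card _ (hE.subset (G.incidenceSet_subset_edgeSet _))]
    · intro e he
      rw [if_neg fun h ↦ ?_]
      have hl := (mem_incidenceFinset.1 he).isLink_neighbor
      rw [h] at hl
      exact hl.ne rfl
  · simp only [if_neg hkl, Finset.sum_const_zero, zero_sub, Finset.sum_boole, edgeCount]
    rw [← Set.ncard_coe_finset]
    congr 3
    ext e
    simp only [Set.mem_ofPred_eq, Finset.coe_filter, mem_incidenceFinset]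
    constructor
    · exact fun h ↦ ⟨h.inc_left, v.injective (Subtype.ext h.neighbor_eq)⟩
    · rintro ⟨h, h'⟩
      rw [← h']
      exact h.isLink_neighbor

lemma det_reducedLaplacian_eq_sum [G.Loopless] (hE : E(G).Finite) :
    (G.reducedLaplacian v).det =
      ∑ p ∈ Fintype.piFinset (edgeChoices hE v), (parentMatrix (G.parentMap v p)).det := by
  classical
  have h := (detRowAlternating (R := ℝ) (n := Fin n)).toMultilinearMap.map_sum_finset
    (fun k (o : Option β) ↦ vertexVec k.succ - vertexVec (o.elim 0 (G.neighbor v k.succ)))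
    (edgeChoices hE v)
  simp only [← reducedLaplacian_row] at h
  exact h

lemma adjugate_reducedLaplacian_eq_sum [G.Loopless] (hE : E(G).Finite) (i j : Fin n) :
    (G.reducedLaplacian v).adjugate i j =
      ∑ p ∈ Fintype.piFinset (Function.update (edgeChoices hE v) j {none}),
        (parentMatrix (G.parentMap v p)).adjugate i j := by
  classical
  -- Row `j` ignores the choice, so any one-element set of choices serves there; `{none}` makes the
  -- sink the parent of `j`.
  let g : Fin n → Option β → Fin n → ℝ := fun k o ↦
    if k = j then Pi.single i 1
    else vertexVec k.succ - vertexVec (o.elim 0 (G.neighbor v k.succ))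
  have h := (detRowAlternating (R := ℝ) (n := Fin n)).toMultilinearMap.map_sum_finset g
    (Function.update (edgeChoices hE v) j {none})
  simp only [adjugate_apply]
  convert h using 2
  · change _ = Matrix.det _
    congr 1
    ext k l
    rcases eq_or_ne k j with rfl | hk
    · simp [g]
    · simp [g, hk, reducedLaplacian_row hE]
  · change _ = Matrix.det _
    congr 1
    ext k l
    rcases eq_or_ne k j with rfl | hk
    · simp [g]
    · simp [g, hk, parentMatrix, parentMap_succ]

/-- The choices of edges that describe the spanning 2-forests with roots `v 0` and `v j.succ` and
with `v i.succ` in the second tree. -/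
def forestChoices (hE : E(G).Finite) (v : Fin (n + 1) ≃ V(G)) (i j : Fin n) :
    Set (Fin n → Option β) :=
  {p | p ∈ Fintype.piFinset (Function.update (edgeChoices hE v) j {none}) ∧
    Descends (G.parentMap v p) ∧ Reaches (G.parentMap v p) i.succ j.succ}

lemma finite_forestChoices (hE : E(G).Finite) (i j : Fin n) : (forestChoices hE v i j).Finite :=
  (Finset.finite_toSet _).subset fun _ hp ↦ hp.1

lemma adjugate_reducedLaplacian [G.Loopless] (hE : E(G).Finite) (i j : Fin n) :
    (G.reducedLaplacian v).adjugate i j = (forestChoices hE v i j).ncard := by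
  classical
  rw [adjugate_reducedLaplacian_eq_sum hE, Finset.sum_congr rfl fun p hp ↦
    adjugate_parentMatrix (parentMap_zero p) (parentMap_eq_zero ?_) i, Finset.sum_boole,
    ← Set.ncard_coe_finset]
  · simp [forestChoices]
  · simpa using Fintype.mem_piFinset.1 hp j

lemma det_reducedLaplacian_pos [G.Loopless] (hE : E(G).Finite) (hG : G.Connected) :
    0 < (G.reducedLaplacian v).det := by
  rw [det_reducedLaplacian_eq_sum hE]
  refine Finset.sum_pos' (fun p _ ↦ ?_) ?_
  · by_cases h : Descends (G.parentMap v p)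
    · rw [det_parentMatrix h]
      exact zero_le_one
    · rw [det_parentMatrix_eq_zero h]
  · obtain ⟨g, h, H⟩ := hG.exists_isParent (v 0).2
    have hstep : ∀ k : Fin n, ∃ e b, g (v k.succ) = some e ∧ G.IsLink e (v k.succ) b ∧
        h b < h (v k.succ) := fun k ↦
      H.step (v k.succ).2 fun h' ↦ Fin.succ_ne_zero k (v.injective (Subtype.ext h'))
    refine ⟨fun k ↦ g (v k.succ), Fintype.mem_piFinset.2 fun k ↦ ?_, ?_⟩
    · obtain ⟨e, b, he, hl, -⟩ := hstep k
      exact mem_edgeChoices.2 ⟨e, he, hl.inc_left⟩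
    · rw [det_parentMatrix ⟨fun x ↦ h (v x), fun x hx ↦ ?_⟩]
      · exact one_pos
      · obtain ⟨k, rfl⟩ := Fin.exists_succ_eq.2 hx
        obtain ⟨e, b, he, hl, hlt⟩ := hstep k
        beta_reduce
        rwa [parentMap_eq (p := fun k ↦ g (v k.succ)) he hl]

/-! ### The bijection between choices of edges and spanning 2-forests -/

/-- The subgraph on the vertices with index in `S` whose edges are those chosen by `p` at these
vertices. -/
def chosenSubgraph (G : Graph α β) (v : Fin (n + 1) ≃ V(G)) (p : Fin n → Option β)
    (S : Set (Fin (n + 1))) : Graph α β where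
  vertexSet := (fun x ↦ (v x : α)) '' S
  IsLink e a b := G.IsLink e a b ∧ (∃ x ∈ S, (v x : α) = a) ∧ (∃ x ∈ S, (v x : α) = b) ∧
    ∃ k : Fin n, k.succ ∈ S ∧ p k = some e
  isLink_symm _ _ := ⟨fun _ _ h ↦ ⟨h.1.symm, h.2.2.1, h.2.1, h.2.2.2⟩⟩
  eq_or_eq_of_isLink_of_isLink _ _ _ _ _ h h' := h.1.left_eq_or_eq h'.1
  left_mem_of_isLink _ _ _ h := h.2.1

lemma chosenSubgraph_le (p : Fin n → Option β) (S : Set (Fin (n + 1))) :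
    G.chosenSubgraph v p S ≤ G where
  vertexSet_mono := by
    rintro _ ⟨x, -, rfl⟩
    exact (v x).2
  isLink_mono _ _ _ h := h.1

lemma mem_chosenSubgraph {p : Fin n → Option β} {S : Set (Fin (n + 1))} {x : Fin (n + 1)} :
    (v x : α) ∈ V(G.chosenSubgraph v p S) ↔ x ∈ S := by
  constructor
  · rintro ⟨y, hy, h⟩
    rwa [← v.injective (Subtype.ext h)]
  · exact fun h ↦ ⟨x, h, rfl⟩

/-- A choice of edges as a function on vertices. -/
noncomputable def edgeAt (v : Fin (n + 1) ≃ V(G)) (p : Fin n → Option β) : α → Option β :=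
  Function.extend (fun k : Fin n ↦ (v k.succ : α)) p fun _ ↦ none

lemma edgeAt_succ (p : Fin n → Option β) (k : Fin n) : edgeAt v p (v k.succ) = p k :=
  Function.Injective.extend_apply (fun _ _ h ↦ Fin.succ_injective _ (v.injective (Subtype.ext h)))
    _ _ _

lemma edgeAt_zero (p : Fin n → Option β) : edgeAt v p (v 0) = none :=
  Function.extend_apply' _ _ _ fun ⟨k, hk⟩ ↦
    Fin.succ_ne_zero k (v.injective (Subtype.ext hk))

/-- The vertices of `S` with the root `r` and the edges chosen by `p` form a rooted tree. -/
lemma isParent_chosenSubgraph {p : Fin n → Option β} {S : Set (Fin (n + 1))} {r : Fin (n + 1)}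
    {h : Fin (n + 1) → ℕ} (hh : ∀ x ≠ 0, h (G.parentMap v p x) < h x) (hr : r ∈ S)
    (h0 : 0 ∈ S → r = 0) (hroot : edgeAt v p (v r) = none)
    (hS : ∀ k : Fin n, k.succ ∈ S → k.succ ≠ r →
      G.parentMap v p k.succ ∈ S ∧ ∃ e, p k = some e ∧ G.Inc e (v k.succ)) :
    (G.chosenSubgraph v p S).IsParent (v r) (edgeAt v p)
      (Function.extend (fun x ↦ (v x : α)) h 0) where
  root_mem := ⟨r, hr, rfl⟩
  root := hroot
  step := by
    rintro _ ⟨x, hx, rfl⟩ hne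
    have hxr : x ≠ r := by
      rintro rfl
      exact hne rfl
    obtain ⟨k, rfl⟩ := Fin.exists_succ_eq.2 fun h' : x = 0 ↦ hxr (by rw [h', h0 (h' ▸ hx)])
    obtain ⟨hm, e, he, b, hl⟩ := hS k hx hxr
    have hb := parentMap_eq he hl
    have hinj : Function.Injective fun x ↦ (v x : α) := Subtype.val_injective.comp v.injective
    refine ⟨e, b, (edgeAt_succ p k).trans he, ⟨hl, ⟨_, hx, rfl⟩, ⟨_, hm, hb⟩, k, hx, he⟩, ?_⟩
    rw [← hb]
    erw [hinj.extend_apply, hinj.extend_apply]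
    exact hh _ (Fin.succ_ne_zero k)

lemma exists_edgeAt_eq_some {p : Fin n → Option β} {S : Set (Fin (n + 1))} :
    ∀ e ∈ E(G.chosenSubgraph v p S), ∃ a ∈ V(G.chosenSubgraph v p S), edgeAt v p a = some e := by
  rintro e ⟨a, b, -, -, -, k, hk, he⟩
  exact ⟨_, ⟨_, hk, rfl⟩, (edgeAt_succ p k).trans he⟩

/-- A rooted tree is recovered from the edges to the parents. -/
lemma chosenSubgraph_eq {T : Graph α β} {r : α} {g : α → Option β} {h : α → ℕ} (hT : T ≤ G)
    (H : T.IsParent r g h) (hc : ¬ T.HasCycle) {p : Fin n → Option β} {S : Set (Fin (n + 1))}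
    (hS : ∀ x, x ∈ S ↔ (v x : α) ∈ V(T)) (h0 : (v 0 : α) ∈ V(T) → r = v 0)
    (hp : ∀ k : Fin n, k.succ ∈ S → p k = g (v k.succ)) : G.chosenSubgraph v p S = T := by
  have hV : ∀ a ∈ V(T), ∃ x ∈ S, (v x : α) = a := fun a ha ↦
    ⟨v.symm ⟨a, hT.vertexSet_mono ha⟩, by simpa [hS] using ha, by simp⟩
  refine Graph.ext (Set.ext fun a ↦ ⟨?_, hV a⟩) fun e a b ↦ ⟨?_, fun hl ↦ ?_⟩
  · rintro ⟨x, hx, rfl⟩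
    exact (hS x).1 hx
  · rintro ⟨hl, -, -, k, hk, he⟩
    have hkr : (v k.succ : α) ≠ r := by
      intro hr
      have := (hp k hk).symm.trans he
      rw [hr, H.root] at this
      simp at this
    obtain ⟨e', c, he', hl', -⟩ := H.step ((hS _).1 hk) hkr
    obtain rfl : e = e' := by simpa [he, he'] using hp k hk
    exact (hT.isLink_iff hl'.edge_mem).2 hl
  · refine ⟨hl.mono hT, hV a hl.left_mem, hV b hl.right_mem, ?_⟩
    obtain ⟨c, hcT, hce⟩ := H.exists_eq_some hc hl.edge_mem
    obtain ⟨x, hx, rfl⟩ := hV c hcT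
    have hx0 : x ≠ 0 := by
      rintro rfl
      rw [← h0 hcT, H.root] at hce
      simp at hce
    obtain ⟨k, rfl⟩ := Fin.exists_succ_eq.2 hx0
    exact ⟨k, hx, (hp k hx).trans hce⟩

/-- The pair of trees described by a choice of edges. -/
def forestOf (G : Graph α β) (v : Fin (n + 1) ≃ V(G)) (j : Fin n) (p : Fin n → Option β) :
    Graph α β × Graph α β :=
  (G.chosenSubgraph v p {x | ¬ Reaches (G.parentMap v p) x j.succ},
    G.chosenSubgraph v p {x | Reaches (G.parentMap v p) x j.succ})

lemma isParent_forestOf {hE : E(G).Finite} {i j : Fin n} {p : Fin n → Option β}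
    (hp : p ∈ forestChoices hE v i j) :
    ∃ h, (G.forestOf v j p).1.IsParent (v 0) (edgeAt v p) h ∧
      (G.forestOf v j p).2.IsParent (v j.succ) (edgeAt v p) h := by
  obtain ⟨hp, ⟨h, hh⟩, -⟩ := hp
  rw [Fintype.mem_piFinset] at hp
  have hj : p j = none := by simpa using hp j
  have hk : ∀ k ≠ j, ∃ e, p k = some e ∧ G.Inc e (v k.succ) := fun k hk ↦ by
    simpa [hk, mem_edgeChoices] using hp k
  have h0 : ¬ Reaches (G.parentMap v p) 0 j.succ :=
    not_reaches_zero (parentMap_zero p) (Fin.succ_ne_zero j)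
  refine ⟨_, isParent_chosenSubgraph hh h0 (fun _ ↦ rfl) (edgeAt_zero p) fun k hkS _ ↦ ?_,
    isParent_chosenSubgraph hh (.refl _) (fun h' ↦ absurd h' h0)
      ((edgeAt_succ p j).trans hj) fun k hkS hne ↦ ?_⟩
  · have hkS' : ¬ (k.succ = j.succ ∨ _) := fun h' ↦ hkS (reaches_iff.2 h')
    rw [not_or] at hkS'
    exact ⟨hkS'.2, hk k fun h' ↦ hkS'.1 (by rw [h'])⟩
  · exact ⟨(reaches_iff.1 hkS).resolve_left hne, hk k fun h' ↦ hne (by rw [h'])⟩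

lemma mapsTo_forestOf (hE : E(G).Finite) (i j : Fin n) :
    Set.MapsTo (G.forestOf v j) (forestChoices hE v i j)
      (G.spanningTwoForests (v 0) (v i.succ) (v j.succ)) := by
  intro p hp
  obtain ⟨h, H₀, H₁⟩ := isParent_forestOf hp
  have hdisj : Disjoint V((G.forestOf v j p).1) V((G.forestOf v j p).2) := by
    rw [Set.disjoint_left]
    rintro _ ⟨x, hx, rfl⟩ h'
    exact hx (mem_chosenSubgraph.1 h')
  refine ⟨⟨?_, ?_, ?_, ?_⟩, H₀.root_mem, mem_chosenSubgraph.2 hp.2.2, H₁.root_mem⟩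
  · exact Fin.forall_fin_two.2 ⟨chosenSubgraph_le p _, chosenSubgraph_le p _⟩
  · exact Fin.forall_fin_two.2 ⟨H₀.isTree exists_edgeAt_eq_some, H₁.isTree exists_edgeAt_eq_some⟩
  · intro a b hab
    fin_cases a <;> fin_cases b
    · exact absurd rfl hab
    · exact hdisj
    · exact hdisj.symm
    · exact absurd rfl hab
  · intro a ha
    obtain ⟨x, hx⟩ := v.surjective ⟨a, ha⟩
    obtain rfl : (v x : α) = a := by rw [hx]
    by_cases hr : Reaches (G.parentMap v p) x j.succ
    · exact ⟨1, mem_chosenSubgraph.2 hr⟩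
    · exact ⟨0, mem_chosenSubgraph.2 hr⟩

lemma injOn_forestOf (hE : E(G).Finite) (i j : Fin n) :
    Set.InjOn (G.forestOf v j) (forestChoices hE v i j) := by
  intro p hp q hq hpq
  obtain ⟨h, H₀, H₁⟩ := isParent_forestOf hp
  obtain ⟨h', H₀', H₁'⟩ := isParent_forestOf hq
  -- Both choices are now parent functions of the same two trees with the same roots, so uniqueness
  -- applies on each tree.
  rw [← hpq] at H₀' H₁'
  ext1 k
  rw [← edgeAt_succ (v := v) p, ← edgeAt_succ (v := v) q]
  by_cases hr : Reaches (G.parentMap v p) k.succ j.succ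
  · exact H₁.eqOn H₁' (H₁.isTree exists_edgeAt_eq_some).acyclic (mem_chosenSubgraph.2 hr)
  · exact H₀.eqOn H₀' (H₀.isTree exists_edgeAt_eq_some).acyclic (mem_chosenSubgraph.2 hr)

lemma surjOn_forestOf (hE : E(G).Finite) (i j : Fin n) :
    Set.SurjOn (G.forestOf v j) (forestChoices hE v i j)
      (G.spanningTwoForests (v 0) (v i.succ) (v j.succ)) := by
  classical
  rintro ⟨T₀, T₁⟩ ⟨⟨hle, htree, hdis, hspan⟩, h0, hi, hj⟩
  obtain ⟨hle₀, hle₁⟩ : T₀ ≤ G ∧ T₁ ≤ G := ⟨hle 0, hle 1⟩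
  obtain ⟨ht₀, ht₁⟩ : T₀.IsTree ∧ T₁.IsTree := ⟨htree 0, htree 1⟩
  have hdisj : Disjoint V(T₀) V(T₁) := hdis (zero_ne_one (α := Fin 2))
  have hmem : ∀ x, (v x : α) ∉ V(T₁) → (v x : α) ∈ V(T₀) := fun x hx ↦ by
    obtain ⟨t, ht⟩ := hspan (v x).2
    fin_cases t
    · exact ht
    · exact absurd ht hx
  have hnot : ∀ {a}, a ∈ V(T₀) → a ∉ V(T₁) := fun ha ↦ Set.disjoint_left.1 hdisj ha
  obtain ⟨g₀, h₀, H₀⟩ := ht₀.connected.exists_isParent h0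
  obtain ⟨g₁, h₁, H₁⟩ := ht₁.connected.exists_isParent hj
  -- The parent functions of the two trees are glued; at the root `v j.succ` this gives `none`.
  let p : Fin n → Option β := fun k ↦
    if (v k.succ : α) ∈ V(T₁) then g₁ (v k.succ) else g₀ (v k.succ)
  have hp₁ : ∀ k : Fin n, (v k.succ : α) ∈ V(T₁) → p k = g₁ (v k.succ) := fun k hk ↦ if_pos hk
  have hp₀ : ∀ k : Fin n, (v k.succ : α) ∉ V(T₁) → p k = g₀ (v k.succ) := fun k hk ↦ if_neg hk
  have step₀ : ∀ k : Fin n, (v k.succ : α) ∉ V(T₁) → ∃ e, p k = some e ∧ G.Inc e (v k.succ) ∧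
      (v (G.parentMap v p k.succ) : α) ∉ V(T₁) ∧
      h₀ (v (G.parentMap v p k.succ)) < h₀ (v k.succ) := fun k hk ↦ by
    obtain ⟨e, b, he, hl, hlt⟩ := H₀.step (hmem _ hk) fun h' ↦
      Fin.succ_ne_zero k (v.injective (Subtype.ext h'))
    rw [← hp₀ k hk] at he
    rw [parentMap_eq he (hl.mono hle₀)]
    exact ⟨e, he, (hl.mono hle₀).inc_left, hnot hl.right_mem, hlt⟩
  have step₁ : ∀ k : Fin n, (v k.succ : α) ∈ V(T₁) → k ≠ j → ∃ e, p k = some e ∧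
      G.Inc e (v k.succ) ∧ (v (G.parentMap v p k.succ) : α) ∈ V(T₁) ∧
      h₁ (v (G.parentMap v p k.succ)) < h₁ (v k.succ) := fun k hk hkj ↦ by
    obtain ⟨e, b, he, hl, hlt⟩ := H₁.step hk fun h' ↦
      hkj (Fin.succ_injective _ (v.injective (Subtype.ext h')))
    rw [← hp₁ k hk] at he
    rw [parentMap_eq he (hl.mono hle₁)]
    exact ⟨e, he, (hl.mono hle₁).inc_left, hl.right_mem, hlt⟩
  have hpj : p j = none := (hp₁ j hj).trans H₁.root
  have hroot := parentMap_eq_zero (G := G) (v := v) hpj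
  have hreach : ∀ x, Reaches (G.parentMap v p) x j.succ ↔ (v x : α) ∈ V(T₁) := by
    refine fun x ↦ ⟨?_, fun hx ↦ ?_⟩
    · rintro ⟨m, hm⟩
      by_contra hx
      induction m generalizing x with
      | zero => exact hx (by rwa [show x = j.succ from hm])
      | succ m ih =>
        refine ih _ hm ?_
        rcases Fin.eq_zero_or_eq_succ x with rfl | ⟨k, rfl⟩
        · exact hx
        · obtain ⟨-, -, -, h', -⟩ := step₀ k hx
          exact h'
    · induction hn : h₁ (v x) using Nat.strong_induction_on generalizing x with
      | h m ih =>
        rcases Fin.eq_zero_or_eq_succ x with rfl | ⟨k, rfl⟩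
        · exact absurd hx (hnot h0)
        · rcases eq_or_ne k j with rfl | hkj
          · exact .refl _
          · obtain ⟨-, -, -, h', hlt⟩ := step₁ k hx hkj
            exact reaches_iff.2 (.inr (ih _ (hn ▸ hlt) _ h' rfl))
  refine ⟨p, ⟨Fintype.mem_piFinset.2 fun k ↦ ?_, ?_, (hreach _).2 hi⟩, Prod.ext ?_ ?_⟩
  · rcases eq_or_ne k j with rfl | hkj
    · simp [hpj]
    · rw [Function.update_of_ne hkj, mem_edgeChoices]
      by_cases hk : (v k.succ : α) ∈ V(T₁)
      · obtain ⟨e, he, hinc, -⟩ := step₁ k hk hkj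
        exact ⟨e, he, hinc⟩
      · obtain ⟨e, he, hinc, -⟩ := step₀ k hk
        exact ⟨e, he, hinc⟩
  · refine ⟨fun x ↦ if (v x : α) ∈ V(T₁) then h₁ (v x) + 1 + h₀ (v 0) else h₀ (v x),
      fun x hx ↦ ?_⟩
    obtain ⟨k, rfl⟩ := Fin.exists_succ_eq.2 hx
    beta_reduce
    by_cases hk : (v k.succ : α) ∈ V(T₁)
    · rcases eq_or_ne k j with rfl | hkj
      · rw [hroot, if_neg (hnot h0), if_pos hk]
        lia
      · obtain ⟨-, -, -, h', hlt⟩ := step₁ k hk hkj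
        rw [if_pos h', if_pos hk]
        lia
    · obtain ⟨-, -, -, h', hlt⟩ := step₀ k hk
      rwa [if_neg h', if_neg hk]
  · exact chosenSubgraph_eq hle₀ H₀ ht₀.acyclic
      (fun x ↦ (not_congr (hreach x)).trans ⟨hmem x, hnot⟩) (fun _ ↦ rfl)
      fun k hk ↦ hp₀ k fun h' ↦ hk ((hreach _).2 h')
  · exact chosenSubgraph_eq hle₁ H₁ ht₁.acyclic hreach (fun h' ↦ absurd h' (hnot h0))
      fun k hk ↦ hp₁ k ((hreach _).1 hk)

lemma bijOn_forestOf (hE : E(G).Finite) (i j : Fin n) :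
    Set.BijOn (G.forestOf v j) (forestChoices hE v i j)
      (G.spanningTwoForests (v 0) (v i.succ) (v j.succ)) :=
  ⟨mapsTo_forestOf hE i j, injOn_forestOf hE i j, surjOn_forestOf hE i j⟩

end Graph

theorem mainTheorem5 {α β : Type*} (G : Graph α β) [G.Loopless] (hE : E(G).Finite)
    (hG : G.Connected) {n : ℕ} (v : Fin (n + 1) ≃ V(G)) :
    IsUnit (G.reducedLaplacian v).det ∧
    (∀ i j : Fin n, (G.spanningTwoForests (v 0) (v i.succ) (v j.succ)).Finite ∧
      (G.reducedLaplacian v)⁻¹ i j =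
        (G.spanningTwoForests (v 0) (v i.succ) (v j.succ)).ncard /
          (G.reducedLaplacian v).det) ∧
    ∀ i j : Fin n, 0 ≤ (G.reducedLaplacian v)⁻¹ i j := by
  have hpos := Graph.det_reducedLaplacian_pos (v := v) hE hG
  have hinv : ∀ i j : Fin n, (G.reducedLaplacian v)⁻¹ i j =
      (G.spanningTwoForests (v 0) (v i.succ) (v j.succ)).ncard / (G.reducedLaplacian v).det :=
    fun i j ↦ by
      rw [Matrix.inv_def, Matrix.smul_apply, Graph.adjugate_reducedLaplacian hE,
        (Graph.bijOn_forestOf hE i j).ncard_eq, Ring.inverse_eq_inv', smul_eq_mul, div_eq_inv_mul]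
  refine ⟨isUnit_iff_ne_zero.2 hpos.ne', fun i j ↦ ⟨?_, hinv i j⟩, fun i j ↦ ?_⟩
  · exact (Graph.bijOn_forestOf hE i j).finite_iff_finite.1 (Graph.finite_forestChoices hE i j)
  · rw [hinv]
    positivity
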